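/- Let $T$ be an infinite, locally finite tree without leaves, and let $\mathrm{Aut}(T)$ carry the permutation topology, i.e. the topology generated by the sets $\{g : g(x)=g_0(x)\ \text{for all } x\in F\}$ with $g_0\in \mathrm{Aut}(T)$ and $F$ a finite set of vertices; subgroups carry the subspace topology. Write $B(v,k)$ for the set of vertices at distance at most $k$ from $v$. For a subgroup $G\le \mathrm{Aut}(T)$ and an integer $k\ge 1$ let $$G^{(k)}=\{g\in \mathrm{Aut}(T) : \text{for every vertex } v \text{ there is } g_0\in G \text{ with } g|_{B(v,k)}=g_0|_{B(v,k)}\}$$ be the $k$-closure of $G$, and let $G^{+_k}$ be the subgroup of $G$ generated by the pointwise stabilisers $\mathrm{Fix}_G(B(v,k)\cap B(w,k))$, where $\{v,w\}$ runs over all edges of $T$. An end of $T$ is an equivalence class of rays (one-sided infinite paths without repeated vertices), where two rays are equivalent if their intersection is a ray. Let $G\le \mathrm{Aut}(T)$ and $k\ge 1$. Suppose that $G$ does not stabilise (setwise) any proper non-empty subtree of $T$ and does not fix any end of $T$. Then $(G^{(k)})^{+_k}$ has the closed range property: for every Hausdorff topological group $H$ and every continuous homomorphism $\varphi:(G^{(k)})^{+_k}\to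 H$, the image of $\varphi$ is closed in $H$. -/

import Mathlib

universe u v

namespace TreeAut

open Set

section Graph

variable {V : Type u} {T : SimpleGraph V}

/-- The closed ball `B(v, n) = {u | d(v, u) ≤ n}`. -/
def ball (T : SimpleGraph V) (x : V) (n : ℕ) : Set V := {y | T.edist x y ≤ n}

theorem edist_le_map (g : T ≃g T) (x y : V) : T.edist (g x) (g y) ≤ T.edist x y :=
  le_iInf fun p => (SimpleGraph.edist_le (p.map g.toHom)).trans (by simp)

theorem edist_map (g : T ≃g T) (x y : V) : T.edist (g x) (g y) = T.edist x y := by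
  refine le_antisymm (edist_le_map g x y) ?_
  simpa using edist_le_map g.symm (g x) (g y)

theorem map_mem_ball (g : T ≃g T) {x y : V} {n : ℕ} :
    g y ∈ ball T (g x) n ↔ y ∈ ball T x n := by
  simp only [ball, mem_ofPred_eq, edist_map]

/-- The basic set `U(g₀, F)` of automorphisms that agree with `g₀` on the finite set `F`. -/
def agreeOn (g₀ : T ≃g T) (F : Finset V) : Set (T ≃g T) := {g | ∀ x ∈ F, g x = g₀ x}

/-- The permutation topology on `Aut(T)`, generated by the sets `U(g₀, F)` with `F` finite. -/
instance autTopology : TopologicalSpace (T ≃g T) :=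
  TopologicalSpace.generateFrom {U | ∃ (g₀ : T ≃g T) (F : Finset V), U = agreeOn g₀ F}

theorem isOpen_agreeOn (g₀ : T ≃g T) (F : Finset V) : IsOpen (agreeOn g₀ F) :=
  TopologicalSpace.isOpen_generateFrom_of_mem ⟨g₀, F, rfl⟩

instance : IsTopologicalGroup (T ≃g T) where
  continuous_mul := by
    classical
    refine continuous_generateFrom_iff.2 ?_
    rintro _ ⟨g₀, F, rfl⟩
    refine isOpen_iff_forall_mem_open.2 ?_
    rintro ⟨g, h⟩ hgh
    refine ⟨agreeOn g (F.image h) ×ˢ agreeOn h F, ?_,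
      (isOpen_agreeOn _ _).prod (isOpen_agreeOn _ _), fun _ _ => rfl, fun _ _ => rfl⟩
    rintro ⟨g', h'⟩ ⟨hg, hh⟩ x hx
    have h1 : h' x = h x := hh x hx
    have h2 : g' (h x) = g (h x) := hg _ (Finset.mem_image_of_mem _ hx)
    have h3 : g (h x) = g₀ x := hgh x hx
    change g' (h' x) = g₀ x
    rw [h1, h2, h3]
  continuous_inv := by
    classical
    refine continuous_generateFrom_iff.2 ?_
    rintro _ ⟨g₀, F, rfl⟩
    refine isOpen_iff_forall_mem_open.2 ?_
    intro g hg
    refine ⟨agreeOn g (F.image g₀), ?_, isOpen_agreeOn _ _, fun _ _ => rfl⟩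
    intro g' hg' x hx
    have h1 : g' (g₀ x) = g (g₀ x) := hg' _ (Finset.mem_image_of_mem _ hx)
    have h2 : g⁻¹ x = g₀ x := hg x hx
    have h3 : g' (g₀ x) = x := by rw [h1, ← h2, RelIso.apply_inv_self]
    calc g'⁻¹ x = g'⁻¹ (g' (g₀ x)) := by rw [h3]
      _ = g₀ x := RelIso.inv_apply_self _ _

/-- The `k`-closure `G^{(k)}`: automorphisms that agree on every ball of radius `k` with some
element of `G`. -/
def kClosure (G : Subgroup (T ≃g T)) (k : ℕ) : Subgroup (T ≃g T) where
  carrier := {g | ∀ x : V, ∃ g₀ ∈ G, ∀ y ∈ ball T x k, g y = g₀ y}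
  one_mem' := fun _ => ⟨1, G.one_mem, fun _ _ => rfl⟩
  mul_mem' := by
    intro g h hg hh x
    obtain ⟨h₀, h₀G, hh₀⟩ := hh x
    obtain ⟨g₀, g₀G, hg₀⟩ := hg (h x)
    refine ⟨g₀ * h₀, G.mul_mem g₀G h₀G, fun y hy => ?_⟩
    rw [RelIso.mul_apply, RelIso.mul_apply, ← hh₀ y hy]
    exact hg₀ _ ((map_mem_ball h).2 hy)
  inv_mem' := by
    intro g hg x
    obtain ⟨g₀, g₀G, hg₀⟩ := hg (g⁻¹ x)
    refine ⟨g₀⁻¹, G.inv_mem g₀G, fun y hy => ?_⟩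
    have h1 : g (g⁻¹ y) = g₀ (g⁻¹ y) := hg₀ _ ((map_mem_ball g⁻¹).2 hy)
    rw [RelIso.apply_inv_self] at h1
    conv_rhs => rw [h1]
    rw [RelIso.inv_apply_self]

/-- The fixator `Fix_G(Y)` of a set `Y` of vertices, as a subgroup of `Aut(T)`. -/
def fixator (G : Subgroup (T ≃g T)) (Y : Set V) : Subgroup (T ≃g T) :=
  G ⊓ fixingSubgroup (T ≃g T) Y

/-- The subgroup `G^{+_k}` generated by the fixators `Fix_G(B(x, k) ∩ B(y, k))` over all edges
`{x, y}` of `T`. -/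
def plus (G : Subgroup (T ≃g T)) (k : ℕ) : Subgroup (T ≃g T) :=
  Subgroup.closure {g | ∃ x y : V, T.Adj x y ∧ g ∈ fixator G (ball T x k ∩ ball T y k)}

/-- `G` stabilises the subgraph `S`: every `g ∈ G` satisfies `g(S) = S`. -/
def Stabilises (G : Subgroup (T ≃g T)) (S : T.Subgraph) : Prop :=
  ∀ g ∈ G, S.map (g : T ≃g T).toHom = S

variable (T) in
/-- A ray: an infinite path `x₀, x₁, x₂, …` without repeated vertices. -/
structure Ray where
  toFun : ℕ → V
  adj : ∀ i, T.Adj (toFun i) (toFun (i + 1))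
  injective : Function.Injective toFun

/-- The image of a ray under an automorphism. -/
def Ray.map (g : T ≃g T) (r : Ray T) : Ray T where
  toFun i := g (r.toFun i)
  adj i := g.map_adj_iff.2 (r.adj i)
  injective := g.injective.comp r.injective

variable (T) in
/-- Two rays are equivalent if they have a common tail. In a tree this says exactly that the
intersection of the two rays is again a ray. -/
def raySetoid : Setoid (Ray T) where
  r r s := ∃ m n : ℕ, ∀ i, r.toFun (m + i) = s.toFun (n + i)
  iseqv :=
    { refl := fun _ => ⟨0, 0, fun _ => rfl⟩
      symm := fun ⟨m, n, h⟩ => ⟨n, m, fun i => (h i).symm⟩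
      trans := by
        rintro r s t ⟨m, n, h⟩ ⟨p, q, h'⟩
        refine ⟨m + p, q + n, fun i => ?_⟩
        have h1 := h (p + i)
        have h2 := h' (n + i)
        have e1 : m + (p + i) = m + p + i := by omega
        have e2 : n + (p + i) = p + (n + i) := by omega
        have e3 : q + (n + i) = q + n + i := by omega
        rw [e1, e2, h2, e3] at h1
        exact h1 }

variable (T) in
/-- The boundary `∂T`, whose elements are the ends of `T`. -/
def Boundary : Type u := Quotient (raySetoid T)

/-- The action of an automorphism on the ends. -/
def Boundary.map (g : T ≃g T) : Boundary T → Boundary T :=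
  Quotient.map (Ray.map g) fun _ _ ⟨m, n, h⟩ => ⟨m, n, fun i => congrArg g (h i)⟩

/-- `G` fixes the end `ε`. -/
def FixesEnd (G : Subgroup (T ≃g T)) (ε : Boundary T) : Prop :=
  ∀ g ∈ G, Boundary.map g ε = ε

end Graph

/-- The closed range property: every continuous homomorphism to a (Hausdorff) topological group
has closed range. -/
def ClosedRangeProperty (G : Type u) [Group G] [TopologicalSpace G] [IsTopologicalGroup G] :
    Prop :=
  ∀ (H : Type v) [Group H] [TopologicalSpace H] [IsTopologicalGroup H] [T2Space H]
    (φ : G →* H), Continuous φ → IsClosed (Set.range φ)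

end TreeAut

/-!
Write `P` for the group `(G^{(k)})^{+_k}` and let `φ : P → H` be a continuous homomorphism with `h`
in the closure of its image. Choose an ultrafilter on `P` along which `φ` tends to `h`.

If, along the ultrafilter, some vertex has a constant image, then the ultrafilter converges in `P`
by local finiteness (`exists_le_nhds_plus_kClosure`), and `h` is the value of `φ` at the limit.

Otherwise the preimages of the vertices converge to an end `ξ` of the tree (`exists_isEndMap`).
If `u ∈ P` fixes pointwise a half-tree containing `ξ`, then `p u p⁻¹` tends to the identity along
the ultrafilter, so `φ u = 1` (`map_eq_one_of_contracted`). It remains to see that the conjugates of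
such elements generate `P`: then `φ` is trivial, and its image is closed after all.

* `P` is generated by its elements fixing a half-tree pointwise, because `G^{(k)}` contains the
  restrictions to the two half-trees at an edge of its elements fixing the intersection of the two
  `k`-balls around the edge (`plus_kClosure_le`).
* A geometrically dense group (one without proper invariant subtrees and fixed ends) moves every
  half-tree onto one containing `ξ` (`GeomDense.exists_apply_eq`). This follows from the fact that
  it moves every proper subtree off itself (`GeomDense.exists_disjoint`).
* `P`, if nontrivial, is geometrically dense, since `G` is and normalises `P`
  (`GeomDense.of_normalised`).

Throughout, an end is handled as the map sending a vertex to the next one in the direction of the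
end (`IsEndMap`), and a subtree as a set of vertices that lies on one side of each vertex outside it
(`Cvx`).
-/

namespace TreeAut

open Set SimpleGraph

variable {V : Type u} {T : SimpleGraph V}

/-! ### Half-trees -/

variable (T) in
/-- The half-tree behind the edge from `x` to `y`: the connected component containing `y` of the
graph obtained from `T` by deleting the edge `{x, y}`. -/
def halfTree (x y : V) : Set V := {z | (T.deleteEdges {s(x, y)}).Reachable y z}

theorem mem_halfTree_self (x y : V) : y ∈ halfTree T x y := Reachable.refl y

/-- A set containing `y` that is closed under passing to neighbours inside `halfTree T x y`
contains the half-tree. -/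
theorem halfTree_induction {x y : V} {C : Set V} (hy : y ∈ C)
    (h : ∀ a b, a ∈ halfTree T x y → b ∈ halfTree T x y → T.Adj a b → a ∈ C → b ∈ C) :
    halfTree T x y ⊆ C := by
  intro z hz
  have hz' := hz
  rw [halfTree, mem_ofPred_eq, reachable_iff_reflTransGen] at hz'
  suffices z ∈ halfTree T x y ∧ z ∈ C from this.2
  clear hz
  induction hz' with
  | refl => exact ⟨mem_halfTree_self x y, hy⟩
  | tail _ hab ih =>
    have hb := Reachable.trans ih.1 hab.reachable
    exact ⟨hb, h _ _ ih.1 hb (deleteEdges_le _ hab) ih.2⟩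

/-- A nonempty set of vertices of a connected graph that is closed under passing to neighbours
contains every vertex. -/
theorem mem_of_forall_adj (hT : T.Connected) {C : Set V} {x : V} (hx : x ∈ C)
    (h : ∀ a b, T.Adj a b → a ∈ C → b ∈ C) (z : V) : z ∈ C := by
  have := hT.preconnected x z
  rw [reachable_iff_reflTransGen] at this
  induction this with
  | refl => exact hx
  | tail _ hab ih => exact h _ _ hab ih

theorem notMem_halfTree (hT : T.IsTree) {x y : V} (h : T.Adj x y) : x ∉ halfTree T x y :=
  fun hx => isAcyclic_iff_forall_isBridge.1 hT.isAcyclic (e := s(x, y)) h (Reachable.symm hx)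

/-- The only edge leaving a half-tree is the edge defining it. -/
theorem eq_of_adj_of_mem_of_notMem (hT : T.IsTree) {x y a b : V} (h : T.Adj x y) (hab : T.Adj a b)
    (ha : a ∈ halfTree T x y) (hb : b ∉ halfTree T x y) : a = y ∧ b = x := by
  by_cases he : s(a, b) = s(x, y)
  · rcases Sym2.eq_iff.1 he with ⟨rfl, rfl⟩ | ⟨rfl, rfl⟩
    · exact absurd ha (notMem_halfTree hT h)
    · exact ⟨rfl, rfl⟩
  · refine absurd (Reachable.trans ha (Adj.reachable ?_)) hb
    rw [deleteEdges_adj]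
    exact ⟨hab, he⟩

theorem mem_halfTree_swap (hT : T.IsTree) {x y z : V} (h : T.Adj x y) :
    z ∈ halfTree T y x ↔ z ∉ halfTree T x y := by
  constructor
  · intro hz hz'
    refine notMem_halfTree hT h (Reachable.trans hz' (Reachable.symm ?_))
    rw [Sym2.eq_swap]
    exact hz
  · refine fun hz => (mem_of_forall_adj (C := halfTree T x y ∪ halfTree T y x) hT.connected
      (Or.inl (mem_halfTree_self x y)) ?_ z).resolve_left hz
    intro a b hab ha
    by_contra hb
    rw [mem_union, not_or] at hb
    rcases ha with ha | ha
    · exact hb.2 ((eq_of_adj_of_mem_of_notMem hT h hab ha hb.1).2 ▸ mem_halfTree_self _ _)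
    · exact hb.1 ((eq_of_adj_of_mem_of_notMem hT h.symm hab ha hb.2).2 ▸ mem_halfTree_self _ _)

/-- A vertex different from `x` lies in at most one half-tree attached to `x`. -/
theorem halfTree_unique (hT : T.IsTree) {x y y' z : V} (h : T.Adj x y) (h' : T.Adj x y')
    (hz : z ∈ halfTree T x y) (hz' : z ∈ halfTree T x y') : y = y' := by
  by_contra hne
  have hy : y ∉ halfTree T x y' := fun hy =>
    hne (eq_of_adj_of_mem_of_notMem hT h' h.symm hy (notMem_halfTree hT h')).1
  refine halfTree_induction (C := (halfTree T x y')ᶜ) hy (fun a b ha hb hab hac hbc => ?_) hz hz'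
  exact notMem_halfTree hT h ((eq_of_adj_of_mem_of_notMem hT h' hab.symm hbc hac).2 ▸ ha)

theorem exists_mem_halfTree (hT : T.IsTree) {x z : V} (hne : z ≠ x) :
    ∃ y, T.Adj x y ∧ z ∈ halfTree T x y := by
  refine (mem_of_forall_adj (C := {z | z = x ∨ ∃ y, T.Adj x y ∧ z ∈ halfTree T x y}) hT.connected
    (Or.inl rfl) ?_ z).resolve_left hne
  rintro a b hab (rfl | ⟨y, hy, ha⟩)
  · exact Or.inr ⟨b, hab, mem_halfTree_self _ _⟩
  · by_cases hb : b ∈ halfTree T x y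
    · exact Or.inr ⟨y, hy, hb⟩
    · exact Or.inl (eq_of_adj_of_mem_of_notMem hT hy hab ha hb).2

theorem map_mem_halfTree_of_mem (hT : T.IsTree) (g : T ≃g T) {x y z : V} (h : T.Adj x y)
    (hz : z ∈ halfTree T x y) : g z ∈ halfTree T (g x) (g y) := by
  refine halfTree_induction (C := {z | g z ∈ halfTree T (g x) (g y)}) (mem_halfTree_self _ _)
    (fun a b ha hb hab hga => ?_) hz
  by_contra hgb
  have := eq_of_adj_of_mem_of_notMem hT (g.map_adj_iff.2 h) (g.map_adj_iff.2 hab) hga hgb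
  exact notMem_halfTree hT h (g.injective this.2 ▸ hb)

theorem map_mem_halfTree (hT : T.IsTree) (g : T ≃g T) {x y z : V} (h : T.Adj x y) :
    g z ∈ halfTree T (g x) (g y) ↔ z ∈ halfTree T x y := by
  refine ⟨fun hz => ?_, map_mem_halfTree_of_mem hT g h⟩
  simpa using map_mem_halfTree_of_mem hT g⁻¹ (g.map_adj_iff.2 h) hz

/-- A shortest path entering a half-tree passes through its boundary edge. -/
theorem dist_add_one_le (hT : T.IsTree) {x y z w : V} (h : T.Adj x y) (hz : z ∉ halfTree T x y)
    (hw : w ∈ halfTree T x y) : T.dist z x + 1 ≤ T.dist z w := by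
  obtain ⟨p, hp⟩ := hT.connected.exists_walk_length_eq_dist z w
  rw [← hp]
  clear hp
  induction p with
  | nil => exact absurd hw hz
  | @cons a b c hab q ih =>
    rw [Walk.length_cons]
    by_cases hb : b ∈ halfTree T x y
    · rw [(eq_of_adj_of_mem_of_notMem hT h hab.symm hb hz).2, dist_self]
      omega
    · have h1 := ih hb hw
      have h2 := hT.connected.dist_triangle (u := a) (v := b) (w := x)
      rw [dist_eq_one_iff_adj.2 hab] at h2
      omega

/-! ### Convex sets of vertices -/

variable (T) in
/-- A set of vertices is convex if every vertex outside it has a neighbour such that the whole set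
lies behind that neighbour. In a tree, the nonempty convex sets are the vertex sets of subtrees. -/
def Cvx (X : Set V) : Prop := ∀ v, v ∉ X → ∃ w, T.Adj v w ∧ X ⊆ halfTree T v w

theorem Cvx.preimage (hT : T.IsTree) {X : Set V} (hX : Cvx T X) (g : T ≃g T) :
    Cvx T {z | g z ∈ X} := by
  intro v hv
  obtain ⟨w, hw, hXw⟩ := hX (g v) hv
  refine ⟨g⁻¹ w, ?_, fun z hz => ?_⟩
  · rw [← g.map_adj_iff, RelIso.apply_inv_self]
    exact hw
  · rw [← map_mem_halfTree hT g, RelIso.apply_inv_self]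
    · exact hXw hz
    · rw [← g.map_adj_iff, RelIso.apply_inv_self]
      exact hw

theorem cvx_halfTree (hT : T.IsTree) {x y : V} (h : T.Adj x y) : Cvx T (halfTree T x y) := by
  intro v hv
  rcases eq_or_ne v x with rfl | hvx
  · exact ⟨y, h, Subset.rfl⟩
  obtain ⟨w, hw, hxw⟩ := exists_mem_halfTree hT hvx.symm
  refine ⟨w, hw, halfTree_induction ?_ ?_⟩
  · by_contra hy
    exact hv ((eq_of_adj_of_mem_of_notMem hT hw h hxw hy).2 ▸ mem_halfTree_self _ _)
  · intro a b _ hb hab haw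
    by_contra hbw
    exact hv ((eq_of_adj_of_mem_of_notMem hT hw hab haw hbw).2 ▸ hb)

/-- The fixed vertices of a set of automorphisms form a convex set, if there are any: a fixed
vertex is equidistant from `v` and `p v`, hence lies on the side of `v` away from `p v`. -/
theorem cvx_setOf_fixed (hT : T.IsTree) (S : Set (T ≃g T)) :
    Cvx T {z | ∀ p ∈ S, p z = z} := by
  intro v hv
  simp only [mem_ofPred_eq, not_forall] at hv
  obtain ⟨p, hp, hpv⟩ := hv
  obtain ⟨y, hy, hpy⟩ := exists_mem_halfTree hT hpv
  refine ⟨y, hy, fun z hz => ?_⟩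
  by_contra hzy
  have h1 := dist_add_one_le hT hy hzy hpy
  have h2 : T.dist (p z) (p v) = T.dist z v := by rw [SimpleGraph.dist, edist_map, SimpleGraph.dist]
  rw [hz p hp] at h2
  omega

/-! ### Ends as shift maps -/

variable (T) in
/-- An end of a tree, encoded as the map sending each vertex to the next vertex on its ray towards
that end: the map never backtracks, and of any two neighbours one is sent to the other. -/
structure IsEndMap (f : V → V) : Prop where
  adj : ∀ x, T.Adj x (f x)
  apply_apply_ne : ∀ x, f (f x) ≠ x
  eq_or_eq : ∀ x y, T.Adj x y → f x = y ∨ f y = x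

/-- The rays towards an end that start at two given vertices have a common tail. -/
theorem IsEndMap.exists_iterate_eq {f : V → V} (hf : IsEndMap T f) (hT : T.IsTree) (x y : V) :
    ∃ m n, f^[m] x = f^[n] y := by
  refine mem_of_forall_adj (C := {y | ∃ m n, f^[m] x = f^[n] y}) hT.connected ⟨0, 0, rfl⟩ ?_ y
  rintro a b hab ⟨m, n, h⟩
  rcases hf.eq_or_eq a b hab with rfl | rfl
  · refine ⟨m + 1, n, ?_⟩
    rw [Function.iterate_succ_apply', h, ← Function.iterate_succ_apply' f,
      Function.iterate_succ_apply]
  · exact ⟨m, n + 1, h⟩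

theorem IsEndMap.mapsTo_halfTree {f : V → V} (hf : IsEndMap T f) (hT : T.IsTree) (x : V) :
    MapsTo f (halfTree T x (f x)) (halfTree T x (f x)) := by
  intro a ha
  by_contra hb
  obtain ⟨h1, h2⟩ := eq_of_adj_of_mem_of_notMem hT (hf.adj x) (hf.adj a) ha hb
  exact hf.apply_apply_ne x (by rw [← h1, h2])

theorem IsEndMap.iterate_mem_halfTree {f : V → V} (hf : IsEndMap T f) (hT : T.IsTree) (x : V)
    (n : ℕ) : f^[n] (f x) ∈ halfTree T x (f x) :=
  (hf.mapsTo_halfTree hT x).iterate n (mem_halfTree_self _ _)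

theorem IsEndMap.injective_iterate {f : V → V} (hf : IsEndMap T f) (hT : T.IsTree) (x : V) :
    Function.Injective fun n => f^[n] x := by
  refine Function.Injective.of_lt_imp_ne fun m n hmn h => ?_
  obtain ⟨j, rfl⟩ := Nat.exists_eq_add_of_lt hmn
  refine notMem_halfTree hT (hf.adj (f^[m] x)) ?_
  have h1 := hf.iterate_mem_halfTree hT (f^[m] x) j
  rw [← Function.iterate_succ_apply, ← Function.iterate_add_apply,
    show j.succ + m = m + j + 1 by omega, ← show f^[m] x = f^[m + j + 1] x from h] at h1
  exact h1

/-- The image of an end under an automorphism. -/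
theorem IsEndMap.conj {f : V → V} (hf : IsEndMap T f) (g : T ≃g T) :
    IsEndMap T fun x => g⁻¹ (f (g x)) where
  adj x := by
    rw [← g.map_adj_iff, RelIso.apply_inv_self]
    exact hf.adj _
  apply_apply_ne x h := by
    rw [RelIso.apply_inv_self] at h
    exact hf.apply_apply_ne (g x) (by simpa using congrArg g h)
  eq_or_eq x y h := by
    rcases hf.eq_or_eq _ _ (g.map_adj_iff.2 h) with h | h
    · exact Or.inl (by rw [h, RelIso.inv_apply_self])
    · exact Or.inr (by rw [h, RelIso.inv_apply_self])

/-! ### Geometrically dense groups -/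

/-- A group of automorphisms of a tree is geometrically dense if it neither stabilises a proper
subtree nor fixes an end. -/
structure GeomDense (Q : Subgroup (T ≃g T)) : Prop where
  eq_univ : ∀ X : Set V, Cvx T X → X.Nonempty → (∀ g ∈ Q, ∀ x ∈ X, g x ∈ X) → X = univ
  not_fix : ∀ f : V → V, IsEndMap T f → ¬ ∀ g ∈ Q, ∀ x, f (g x) = g (f x)

/-- A geometrically dense group moves every proper subtree off itself. Otherwise the translates of
the subtree meet pairwise; each vertex lies outside some of them, and the direction in which those
lie does not depend on the translate. These directions define a fixed end. -/
theorem GeomDense.exists_disjoint {Q : Subgroup (T ≃g T)} (hQ : GeomDense Q) (hT : T.IsTree)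
    {X : Set V} (hX : Cvx T X) (huniv : X ≠ univ) :
    ∃ g ∈ Q, ∀ x ∈ X, g x ∉ X := by
  by_contra! hcon
  have hmeet : ∀ g ∈ Q, ∀ h ∈ Q, ∃ z, g z ∈ X ∧ h z ∈ X := by
    intro g hg h hh
    obtain ⟨x, hx, hx'⟩ := hcon (h * g⁻¹) (Q.mul_mem hh (Q.inv_mem hg))
    exact ⟨g⁻¹ x, by rwa [RelIso.apply_inv_self], hx'⟩
  have hdir : ∀ v, ∃ w, T.Adj v w ∧ ∃ g ∈ Q, {z | g z ∈ X} ⊆ halfTree T v w := by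
    intro v
    suffices ∃ g ∈ Q, g v ∉ X by
      obtain ⟨g, hg, hgv⟩ := this
      obtain ⟨w, hw, hXw⟩ := hX.preimage hT g v hgv
      exact ⟨w, hw, g, hg, hXw⟩
    by_contra! hv
    have hY := hQ.eq_univ {z | ∀ g ∈ Q, g z ∈ X} ?_ ⟨v, hv⟩ ?_
    · refine huniv (eq_univ_of_forall fun z => ?_)
      have hz : z ∈ {z | ∀ g ∈ Q, g z ∈ X} := hY ▸ mem_univ z
      exact hz 1 Q.one_mem
    · intro z hz
      simp only [mem_ofPred_eq, not_forall] at hz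
      obtain ⟨g, hg, hgz⟩ := hz
      obtain ⟨w, hw, hXw⟩ := hX.preimage hT g z hgz
      exact ⟨w, hw, fun y hy => hXw (hy g hg)⟩
    · exact fun g hg x hx h hh => hx (h * g) (Q.mul_mem hh hg)
  choose f hf k hk hkf using hdir
  have huniq : ∀ v w, T.Adj v w → ∀ g ∈ Q, {z | g z ∈ X} ⊆ halfTree T v w → f v = w := by
    intro v w hvw g hg hgw
    obtain ⟨z, hz, hz'⟩ := hmeet g hg (k v) (hk v)
    exact halfTree_unique hT (hf v) hvw (hkf v hz') (hgw hz)
  refine hQ.not_fix f ⟨hf, fun x hx => ?_, fun x y hxy => ?_⟩ fun q hq x => ?_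
  · obtain ⟨z, hz, hz'⟩ := hmeet _ (hk x) _ (hk (f x))
    have h1 := hkf _ hz'
    rw [hx, mem_halfTree_swap hT (hf x)] at h1
    exact h1 (hkf _ hz)
  · by_contra! hne
    refine hne.2 (huniq y x hxy.symm (k x) (hk x) fun z hz => ?_)
    rw [mem_halfTree_swap hT hxy]
    exact fun hz' => hne.1 (halfTree_unique hT (hf x) hxy (hkf x hz) hz')
  · refine huniq _ _ (q.map_adj_iff.2 (hf x)) (k x * q⁻¹)
      (Q.mul_mem (hk x) (Q.inv_mem hq)) fun z hz => ?_
    have h1 : q⁻¹ z ∈ halfTree T x (f x) := hkf x hz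
    rwa [← map_mem_halfTree hT q (hf x), RelIso.apply_inv_self] at h1

/-- A geometrically dense group moves any half-tree onto one containing a given end. -/
theorem GeomDense.exists_apply_eq {Q : Subgroup (T ≃g T)} (hQ : GeomDense Q) (hT : T.IsTree)
    {f : V → V} (hf : IsEndMap T f) {x y : V} (h : T.Adj x y) : ∃ g ∈ Q, f (g x) = g y := by
  by_contra! hcon
  have hrev : ∀ g ∈ Q, f (g y) = g x := fun g hg =>
    (hf.eq_or_eq _ _ (g.map_adj_iff.2 h)).resolve_left (hcon g hg)
  obtain ⟨g, hg, hdisj⟩ := hQ.exists_disjoint hT (cvx_halfTree hT h.symm)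
    fun huniv => notMem_halfTree hT h.symm (huniv ▸ mem_univ y)
  -- The ray towards the end eventually lies in both `halfTree T y x` and its translate by `g`.
  obtain ⟨m, n, hmn⟩ := hf.exists_iterate_eq hT x (g x)
  have h1 := hf.iterate_mem_halfTree hT y m
  have h2 := hf.iterate_mem_halfTree hT (g y) n
  have h3 : f y = x := hrev 1 Q.one_mem
  rw [h3, hmn] at h1
  rw [hrev g hg, ← RelIso.apply_inv_self g (f^[n] (g x)), map_mem_halfTree hT g h.symm] at h2
  exact hdisj _ h2 (by rwa [RelIso.apply_inv_self])

/-- A group stabilising two disjoint subtrees fixes the end point in the first of them of the path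
joining them. -/
theorem exists_fixed_of_disjoint (hT : T.IsTree) {P : Subgroup (T ≃g T)} {X Y : Set V}
    (hX : Cvx T X) (hY : Cvx T Y) (hXne : X.Nonempty) (hYne : Y.Nonempty)
    (hPX : ∀ p ∈ P, ∀ x ∈ X, p x ∈ X) (hPY : ∀ p ∈ P, ∀ y ∈ Y, p y ∈ Y)
    (hdisj : ∀ x ∈ X, x ∉ Y) : ∃ x, ∀ p ∈ P, p x = x := by
  obtain ⟨y, hy⟩ := hYne
  obtain ⟨x, hx, hmin⟩ : ∃ x ∈ X, ∀ x' ∈ X, T.dist y x ≤ T.dist y x' := by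
    obtain ⟨x, hx⟩ := exists_minimalFor_of_wellFoundedLT (· ∈ X) (T.dist y) hXne
    exact ⟨x, hx.1, fun x' hx' => not_lt.1 fun hlt => (hlt.not_ge (hx.2 hx' hlt.le)).elim⟩
  have hxy : y ≠ x := fun h => hdisj x hx (h ▸ hy)
  obtain ⟨x₁, hadj, hyx₁⟩ := exists_mem_halfTree hT hxy
  have hYsub : Y ⊆ halfTree T x x₁ := by
    obtain ⟨w, hw, hYw⟩ := hY x (hdisj x hx)
    rwa [halfTree_unique hT hadj hw hyx₁ (hYw hy)]
  have hx₁ : x₁ ∉ X := fun h => by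
    have h1 := hmin x₁ h
    have h2 := dist_add_one_le hT hadj.symm
      (fun h => (mem_halfTree_swap hT hadj).1 h hyx₁) (mem_halfTree_self x₁ x)
    omega
  have hXsub : X ⊆ halfTree T x₁ x := by
    obtain ⟨w, hw, hXw⟩ := hX x₁ hx₁
    rwa [halfTree_unique hT hadj.symm hw (mem_halfTree_self _ _) (hXw hx)]
  refine ⟨x, fun p hp => ?_⟩
  have hpadj : T.Adj (p x) (p x₁) := p.map_adj_iff.2 hadj
  have hpy : y ∈ halfTree T (p x) (p x₁) := by
    rw [← RelIso.apply_inv_self p y, map_mem_halfTree hT p hadj]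
    exact hYsub (hPY _ (P.inv_mem hp) _ hy)
  have hpx : x ∉ halfTree T (p x) (p x₁) := by
    rw [← RelIso.apply_inv_self p x, RelIso.apply_inv_self p x, ← mem_halfTree_swap hT hpadj]
    have := hXsub (hPX _ (P.inv_mem hp) _ hx)
    rwa [← map_mem_halfTree hT p hadj.symm, RelIso.apply_inv_self] at this
  have hpx' : p x ∉ halfTree T x x₁ := (mem_halfTree_swap hT hadj).1 (hXsub (hPX p hp x hx))
  by_cases h1 : p x₁ ∈ halfTree T x x₁
  · exact (eq_of_adj_of_mem_of_notMem hT hadj hpadj.symm h1 hpx').2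
  · refine absurd hyx₁ (halfTree_induction (C := (halfTree T x x₁)ᶜ) h1
      (fun a b ha _ hab haC hbC => ?_) hpy)
    exact hpx ((eq_of_adj_of_mem_of_notMem hT hadj hab.symm hbC haC).2 ▸ ha)

/-- A group normalised by a geometrically dense group is itself geometrically dense as soon as it
has a nontrivial element fixing a vertex. If it stabilised a proper subtree, it would stabilise two
disjoint ones, hence fix a vertex, hence all vertices. If it fixed an end, it would also fix the
translates of that end, hence its elements fixing a vertex would be trivial. -/
theorem GeomDense.of_normalised {Q P : Subgroup (T ≃g T)} (hQ : GeomDense Q) (hT : T.IsTree)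
    (hnorm : ∀ g ∈ Q, ∀ p ∈ P, g * p * g⁻¹ ∈ P) {u : T ≃g T} (hu : u ∈ P) (hu1 : u ≠ 1)
    {b : V} (hb : u b = b) : GeomDense P := by
  obtain ⟨v, hv⟩ : ∃ v, u v ≠ v := by
    by_contra! h
    exact hu1 (RelIso.ext h)
  have hnorm' : ∀ g ∈ Q, ∀ p ∈ P, g⁻¹ * p * g ∈ P := fun g hg p hp => by
    simpa using hnorm g⁻¹ (Q.inv_mem hg) p hp
  constructor
  · intro X hX hne hinv
    by_contra huniv
    obtain ⟨g, hg, hdisj⟩ := hQ.exists_disjoint hT hX huniv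
    obtain ⟨x, hx⟩ := exists_fixed_of_disjoint hT hX (hX.preimage hT g) hne
      (hne.imp' (fun x => g⁻¹ x) fun x hx => by rwa [mem_ofPred_eq, RelIso.apply_inv_self])
      hinv (fun p hp y hy => by simpa using hinv _ (hnorm g hg p hp) _ hy) hdisj
    have hfix := hQ.eq_univ _ (cvx_setOf_fixed hT (P : Set (T ≃g T))) ⟨x, hx⟩
      fun g hg z hz p hp => by
        simpa [RelIso.mul_apply] using congrArg g (hz _ (hnorm' g hg p hp))
    have hvfix : v ∈ {z | ∀ p ∈ (P : Set (T ≃g T)), p z = z} := hfix ▸ mem_univ v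
    exact hv (hvfix u hu)
  · intro f hf hfix
    have hbv : b ≠ v := fun h => hv (h ▸ hb)
    obtain ⟨v', hadj, hbv'⟩ := exists_mem_halfTree hT hbv
    -- Move the fixed end behind `v`, as seen from the fixed vertex `b`.
    obtain ⟨g, hg, hfg⟩ := hQ.exists_apply_eq hT hf hadj.symm
    have hf' := hf.conj g
    set f' : V → V := fun x => g⁻¹ (f (g x)) with hf'def
    have hf'v : f' v' = v := by rw [hf'def]; simp [hfg]
    have hf'u : ∀ z, f' (u z) = u (f' z) := fun z => by
      have := hfix _ (hnorm g hg u hu) (g z)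
      simp only [RelIso.mul_apply, RelIso.inv_apply_self] at this
      rw [hf'def]
      simp only [this, RelIso.inv_apply_self]
    have hfixed : ∀ n, u (f'^[n] b) = f'^[n] b := by
      intro n
      induction n with
      | zero => exact hb
      | succ n ih => rw [Function.iterate_succ_apply', ← hf'u, ih]
    -- The ray from `b` towards the moved end is fixed by `u`, so it cannot pass through `v`.
    have hstay : ∀ n, f'^[n] b ∉ halfTree T v' v := by
      intro n
      induction n with
      | zero => exact fun h => (mem_halfTree_swap hT hadj).1 h hbv'
      | succ n ih =>
        intro h
        rw [Function.iterate_succ_apply'] at h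
        have := (eq_of_adj_of_mem_of_notMem hT hadj.symm (hf'.adj _).symm h ih).1
        rw [← Function.iterate_succ_apply' f'] at this
        exact hv (this ▸ hfixed (n + 1))
    obtain ⟨m, n, hmn⟩ := hf'.exists_iterate_eq hT b v'
    refine hstay (m + 1) ?_
    have := hf'.iterate_mem_halfTree hT v' n
    rwa [← Function.iterate_succ_apply, Function.iterate_succ_apply', ← hmn,
      ← Function.iterate_succ_apply' f', hf'v] at this

/-! ### Invariant subtrees and fixed ends -/

/-- A nonempty convex set of vertices spans a subtree. -/
theorem Cvx.isTree_induce (hT : T.IsTree) {X : Set V} (hX : Cvx T X) (hne : X.Nonempty) :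
    ((⊤ : T.Subgraph).induce X).coe.IsTree := by
  have key : ∀ n (a b : ((⊤ : T.Subgraph).induce X).verts), T.dist (b : V) (a : V) = n →
      ((⊤ : T.Subgraph).induce X).coe.Reachable a b := by
    intro n
    induction n using Nat.strong_induction_on with
    | _ n ih =>
    rintro ⟨a, ha⟩ ⟨b, hb⟩ hn
    rcases eq_or_ne b a with rfl | hne
    · rfl
    obtain ⟨c, hac, hbc⟩ := exists_mem_halfTree hT hne
    have hc : c ∈ X := by
      by_contra hc
      obtain ⟨w, hw, hXw⟩ := hX c hc
      obtain rfl := halfTree_unique hT hw hac.symm (hXw ha) (mem_halfTree_self _ _)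
      exact (mem_halfTree_swap hT hac).1 (hXw hb) hbc
    have hlt := dist_add_one_le hT hac.symm
      (fun h => (mem_halfTree_swap hT hac).1 h hbc) (mem_halfTree_self c a)
    have h1 : ((⊤ : T.Subgraph).induce X).coe.Adj ⟨a, ha⟩ ⟨c, hc⟩ := by
      simpa using ⟨ha, hc, hac⟩
    exact h1.reachable.trans (ih (T.dist b c) (by simp only at hn; omega) ⟨c, hc⟩ ⟨b, hb⟩ rfl)
  have : Nonempty ((⊤ : T.Subgraph).induce X).verts := hne.to_subtype
  exact ⟨⟨fun a b => key _ a b rfl⟩, hT.isAcyclic.subgraph _⟩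

theorem stabilises_induce {G : Subgroup (T ≃g T)} {X : Set V} (h : ∀ g ∈ G, ∀ x ∈ X, g x ∈ X) :
    Stabilises G ((⊤ : T.Subgraph).induce X) := by
  intro g hg
  have hmem : ∀ x, g x ∈ X ↔ x ∈ X := fun x =>
    ⟨fun hx => by simpa using h g⁻¹ (G.inv_mem hg) _ hx, h g hg x⟩
  have hinv : ∀ x, g (g⁻¹ x) = x := RelIso.apply_inv_self g
  refine Subgraph.ext ?_ ?_
  · ext x
    simp only [Subgraph.map_verts, Subgraph.induce_verts, mem_image]
    exact ⟨fun ⟨y, hy, hyx⟩ => hyx ▸ h g hg y hy,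
      fun hx => ⟨g⁻¹ x, h _ (G.inv_mem hg) x hx, hinv x⟩⟩
  · ext a b
    simp only [Subgraph.map_adj, Relation.Map, Subgraph.induce_adj, Subgraph.top_adj]
    constructor
    · rintro ⟨a, b, ⟨ha, hb, hab⟩, rfl, rfl⟩
      exact ⟨h g hg a ha, h g hg b hb, g.map_adj_iff.2 hab⟩
    · rintro ⟨ha, hb, hab⟩
      exact ⟨g⁻¹ a, g⁻¹ b, ⟨h _ (G.inv_mem hg) a ha, h _ (G.inv_mem hg) b hb,
        g⁻¹.map_adj_iff.2 hab⟩, hinv a, hinv b⟩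

/-- The ray from `x` towards the end encoded by `f`. -/
def IsEndMap.ray {f : V → V} (hf : IsEndMap T f) (hT : T.IsTree) (x : V) : Ray T where
  toFun n := f^[n] x
  adj n := by
    rw [Function.iterate_succ_apply']
    exact hf.adj _
  injective := hf.injective_iterate hT x

theorem IsEndMap.fixesEnd {f : V → V} (hf : IsEndMap T f) (hT : T.IsTree) {G : Subgroup (T ≃g T)}
    (hcomm : ∀ g ∈ G, ∀ x, f (g x) = g (f x)) (x : V) :
    FixesEnd G (Quotient.mk (raySetoid T) (hf.ray hT x)) := by
  intro g hg
  have hiter : ∀ n, g (f^[n] x) = f^[n] (g x) := fun n =>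
    Function.Semiconj.iterate_right (f := g) (fun z => (hcomm g hg z).symm) n x
  obtain ⟨m, n, hmn⟩ := hf.exists_iterate_eq hT (g x) x
  refine Quotient.sound ⟨m, n, fun i => ?_⟩
  change g (f^[m + i] x) = f^[n + i] x
  rw [hiter, add_comm m, add_comm n, Function.iterate_add_apply, hmn, ← Function.iterate_add_apply]

theorem GeomDense.of_not_exists [Nonempty V] (hT : T.IsTree) {G : Subgroup (T ≃g T)}
    (hsub : ¬ ∃ S : T.Subgraph, S.coe.IsTree ∧ S ≠ ⊤ ∧ Stabilises G S)
    (hend : ¬ ∃ ε : Boundary T, FixesEnd G ε) : GeomDense G where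
  eq_univ X hX hne hinv := by
    by_contra huniv
    refine hsub ⟨_, hX.isTree_induce hT hne, fun h => huniv ?_, stabilises_induce hinv⟩
    simpa using congrArg Subgraph.verts h
  not_fix f hf hcomm := hend ⟨_, hf.fixesEnd hT hcomm (Classical.arbitrary V)⟩

/-! ### The `k`-closure and fixators of half-trees -/

theorem le_kClosure (G : Subgroup (T ≃g T)) (k : ℕ) : G ≤ kClosure G k :=
  fun g hg _ => ⟨g, hg, fun _ _ => rfl⟩

theorem plus_le (G : Subgroup (T ≃g T)) (k : ℕ) : plus G k ≤ G :=
  (Subgroup.closure_le _).2 fun _ ⟨_, _, _, hg⟩ => hg.1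

theorem mem_fixator {G : Subgroup (T ≃g T)} {Y : Set V} {g : T ≃g T} :
    g ∈ fixator G Y ↔ g ∈ G ∧ ∀ y ∈ Y, g y = y := by
  rw [fixator, Subgroup.mem_inf, mem_fixingSubgroup_iff]
  rfl

theorem mem_plus_of_fix {G : Subgroup (T ≃g T)} {k : ℕ} {x y : V} (h : T.Adj x y) {g : T ≃g T}
    (hg : g ∈ G) (hfix : ∀ z ∈ ball T x k ∩ ball T y k, g z = z) : g ∈ plus G k :=
  Subgroup.subset_closure ⟨x, y, h, mem_fixator.2 ⟨hg, hfix⟩⟩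

theorem conj_mem_plus (G : Subgroup (T ≃g T)) (k : ℕ) :
    ∀ g ∈ G, ∀ p ∈ plus G k, g * p * g⁻¹ ∈ plus G k := by
  intro g hg p hp
  induction hp using Subgroup.closure_induction with
  | mem p hp =>
    obtain ⟨x, y, hxy, hp⟩ := hp
    rw [mem_fixator] at hp
    refine mem_plus_of_fix (g.map_adj_iff.2 hxy) (G.mul_mem (G.mul_mem hg hp.1) (G.inv_mem hg)) ?_
    rintro z ⟨hz, hz'⟩
    rw [← RelIso.apply_inv_self g z, map_mem_ball] at hz hz'
    rw [RelIso.mul_apply, RelIso.mul_apply, hp.2 _ ⟨hz, hz'⟩, RelIso.apply_inv_self]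
  | one => simp
  | mul a b _ _ ha hb => simpa [mul_assoc] using (plus G k).mul_mem ha hb
  | inv a _ ha => simpa [mul_assoc] using (plus G k).inv_mem ha

theorem mem_ball_iff (hT : T.IsTree) {x y : V} {k : ℕ} : y ∈ ball T x k ↔ T.dist x y ≤ k := by
  rw [ball, mem_ofPred_eq, ← (hT.connected.preconnected x y).coe_dist_eq_edist, Nat.cast_le]

theorem ball_finite (hT : T.IsTree) [T.LocallyFinite] (x : V) (k : ℕ) : (ball T x k).Finite := by
  induction k with
  | zero =>
    refine (finite_singleton x).subset fun y hy => ?_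
    rw [mem_ball_iff hT, Nat.le_zero, hT.connected.dist_eq_zero_iff] at hy
    exact hy.symm
  | succ k ih =>
    refine (ih.union (ih.biUnion fun z _ => (T.neighborSet z).toFinite)).subset fun y hy => ?_
    rcases eq_or_ne x y with rfl | hne
    · exact Or.inl ((mem_ball_iff hT).2 (by simp))
    obtain ⟨z, hz, hxz⟩ := exists_mem_halfTree hT hne
    have := dist_add_one_le hT hz.symm (fun h => (mem_halfTree_swap hT hz).1 h hxz)
      (mem_halfTree_self z y)
    rw [mem_ball_iff hT] at hy
    exact Or.inr (mem_iUnion₂.2 ⟨z, (mem_ball_iff hT).2 (by omega), hz.symm⟩)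

/-- A ball centred outside a half-tree meets it only in the intersection of the two balls of the
same radius around the ends of its boundary edge. -/
theorem mem_ball_inter_ball (hT : T.IsTree) {x y v z : V} {k : ℕ} (h : T.Adj x y)
    (hv : v ∉ halfTree T x y) (hz : z ∈ halfTree T x y) (hvz : z ∈ ball T v k) :
    z ∈ ball T x k ∩ ball T y k := by
  have h1 := dist_add_one_le hT h.symm (fun h' => (mem_halfTree_swap hT h).1 h' hz)
    ((mem_halfTree_swap hT h).2 hv)
  have h2 := hT.connected.dist_triangle (u := x) (v := y) (w := z)
  rw [dist_eq_one_iff_adj.2 h] at h2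
  rw [mem_ball_iff hT] at hvz
  rw [T.dist_comm, T.dist_comm (u := z)] at h1
  rw [mem_inter_iff, mem_ball_iff hT, mem_ball_iff hT]
  omega

open Classical in
/-- The automorphism that agrees with `u` on the half-tree `halfTree T x y` and is the identity
elsewhere, where `u` fixes `x` and `y`. -/
noncomputable def restrictHalfTree (hT : T.IsTree) {x y : V} (h : T.Adj x y) (u : T ≃g T)
    (hx : u x = x) (hy : u y = y) : T ≃g T where
  toFun z := if z ∈ halfTree T x y then u z else z
  invFun z := if z ∈ halfTree T x y then u⁻¹ z else z
  left_inv z := by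
    have hm : u z ∈ halfTree T x y ↔ z ∈ halfTree T x y := by
      simpa only [hx, hy] using map_mem_halfTree hT u h (z := z)
    by_cases hz : z ∈ halfTree T x y <;> simp [hz, hm]
  right_inv z := by
    have hm : u (u⁻¹ z) ∈ halfTree T x y ↔ u⁻¹ z ∈ halfTree T x y := by
      simpa only [hx, hy] using map_mem_halfTree hT u h (z := u⁻¹ z)
    rw [RelIso.apply_inv_self] at hm
    by_cases hz : z ∈ halfTree T x y <;> simp [hz, ← hm]
  map_rel_iff' {a b} := by
    have hm : ∀ z, u z ∈ halfTree T x y ↔ z ∈ halfTree T x y := fun z => by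
      simpa only [hx, hy] using map_mem_halfTree hT u h (z := z)
    have hcross : ∀ a b, a ∈ halfTree T x y → b ∉ halfTree T x y → (T.Adj (u a) b ↔ T.Adj a b) := by
      intro a b ha hb
      constructor <;> intro hab
      · obtain ⟨h1, rfl⟩ := eq_of_adj_of_mem_of_notMem hT h hab ((hm a).2 ha) hb
        rwa [← u.map_adj_iff, hx]
      · obtain ⟨rfl, rfl⟩ := eq_of_adj_of_mem_of_notMem hT h hab ha hb
        rwa [hy]
    by_cases ha : a ∈ halfTree T x y <;> by_cases hb : b ∈ halfTree T x y
    · simpa [ha, hb] using u.map_adj_iff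
    · simpa [ha, hb] using hcross a b ha hb
    · simpa [ha, hb, T.adj_comm] using hcross b a hb ha
    · simp [ha, hb]

theorem restrictHalfTree_of_mem (hT : T.IsTree) {x y z : V} (h : T.Adj x y) (u : T ≃g T)
    (hx : u x = x) (hy : u y = y) (hz : z ∈ halfTree T x y) :
    restrictHalfTree hT h u hx hy z = u z := if_pos hz

theorem restrictHalfTree_of_notMem (hT : T.IsTree) {x y z : V} (h : T.Adj x y) (u : T ≃g T)
    (hx : u x = x) (hy : u y = y) (hz : z ∉ halfTree T x y) :
    restrictHalfTree hT h u hx hy z = z := if_neg hz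

/-- The `k`-closure is large enough to contain the restrictions to half-trees of its elements that
fix the intersection of the balls around the two ends of the boundary edge: on each ball of radius
`k`, such a restriction agrees with the element itself or with the identity. -/
theorem restrictHalfTree_mem_kClosure (hT : T.IsTree) {G : Subgroup (T ≃g T)} {k : ℕ} {x y : V}
    (h : T.Adj x y) {u : T ≃g T} (hx : u x = x) (hy : u y = y) (hu : u ∈ kClosure G k)
    (hfix : ∀ z ∈ ball T x k ∩ ball T y k, u z = z) :
    restrictHalfTree hT h u hx hy ∈ kClosure G k := by
  intro v
  by_cases hv : v ∈ halfTree T x y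
  · obtain ⟨g, hg, hgu⟩ := hu v
    refine ⟨g, hg, fun z hz => ?_⟩
    rw [← hgu z hz]
    by_cases hz' : z ∈ halfTree T x y
    · exact restrictHalfTree_of_mem hT h u hx hy hz'
    · rw [restrictHalfTree_of_notMem hT h u hx hy hz', hfix z]
      rw [inter_comm]
      exact mem_ball_inter_ball hT h.symm (fun h' => (mem_halfTree_swap hT h).1 h' hv)
        ((mem_halfTree_swap hT h).2 hz') hz
  · refine ⟨1, G.one_mem, fun z hz => ?_⟩
    by_cases hz' : z ∈ halfTree T x y
    · rw [restrictHalfTree_of_mem hT h u hx hy hz', hfix z (mem_ball_inter_ball hT h hv hz' hz)]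
      rfl
    · exact restrictHalfTree_of_notMem hT h u hx hy hz'

/-- The group `(G^{(k)})^{+_k}` is generated by its elements fixing a half-tree pointwise: each of
its defining generators is the product of its restrictions to two complementary half-trees. -/
theorem plus_kClosure_le (hT : T.IsTree) {G : Subgroup (T ≃g T)} {k : ℕ} (hk : 1 ≤ k)
    {N : Subgroup (T ≃g T)} (hN : ∀ x y, T.Adj x y → ∀ u ∈ plus (kClosure G k) k,
      (∀ z ∈ halfTree T x y, u z = z) → u ∈ N) : plus (kClosure G k) k ≤ N := by
  refine (Subgroup.closure_le _).2 ?_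
  rintro u ⟨x, y, hxy, hu⟩
  rw [mem_fixator] at hu
  obtain ⟨hu, hfix⟩ := hu
  have hd : T.dist x y = 1 := dist_eq_one_iff_adj.2 hxy
  have hx : u x = x := hfix x ⟨(mem_ball_iff hT).2 (by simp), (mem_ball_iff hT).2
    (by rw [T.dist_comm]; omega)⟩
  have hy : u y = y := hfix y ⟨(mem_ball_iff hT).2 (by omega), (mem_ball_iff hT).2 (by simp)⟩
  have hfix' : ∀ z ∈ ball T y k ∩ ball T x k, u z = z := fun z hz => hfix z hz.symm
  have key : ∀ a b (hab : T.Adj a b) (ha : u a = a) (hb : u b = b),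
      (∀ z ∈ ball T a k ∩ ball T b k, u z = z) → restrictHalfTree hT hab u ha hb ∈ N := by
    intro a b hab ha hb hfix
    have hout : ∀ z, z ∉ halfTree T a b → restrictHalfTree hT hab u ha hb z = z := fun z hz =>
      restrictHalfTree_of_notMem hT hab u ha hb hz
    refine hN b a hab.symm _ (mem_plus_of_fix hab
      (restrictHalfTree_mem_kClosure hT hab ha hb hu hfix) fun z hz => ?_)
      fun z hz => hout z ((mem_halfTree_swap hT hab).1 hz)
    by_cases hz' : z ∈ halfTree T a b
    · rw [restrictHalfTree_of_mem hT hab u ha hb hz', hfix z hz]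
    · exact hout z hz'
  have hprod : u = restrictHalfTree hT hxy u hx hy * restrictHalfTree hT hxy.symm u hy hx := by
    ext z
    rw [RelIso.mul_apply]
    by_cases hz : z ∈ halfTree T x y
    · rw [restrictHalfTree_of_notMem hT hxy.symm u hy hx
        fun h => (mem_halfTree_swap hT hxy).1 h hz, restrictHalfTree_of_mem hT hxy u hx hy hz]
    · have huz : u z ∉ halfTree T x y := fun h => hz <| by
        rwa [← map_mem_halfTree hT u hxy, hx, hy]
      rw [restrictHalfTree_of_mem hT hxy.symm u hy hx ((mem_halfTree_swap hT hxy).2 hz),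
        restrictHalfTree_of_notMem hT hxy u hx hy huz]
  rw [hprod]
  exact N.mul_mem (key x y hxy hx hy hfix) (key y x hxy.symm hy hx hfix')

/-! ### Ultrafilters of automorphisms -/

open Filter Topology

theorem tendsto_aut {ι : Type*} {l : Filter ι} {F : ι → T ≃g T} {g : T ≃g T}
    (h : ∀ z, ∀ᶠ i in l, F i z = g z) : Tendsto F l (𝓝 g) := by
  rw [TopologicalSpace.tendsto_nhds_generateFrom_iff]
  rintro _ ⟨g₀, S, rfl⟩ hg
  have := (eventually_all_finset S).2 fun z _ => h z
  filter_upwards [this] with i hi z hz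
  rw [hi z hz]
  exact hg z hz

theorem exists_eventually_apply_eq [T.LocallyFinite] (hT : T.IsTree) {ι : Type*}
    (U : Ultrafilter ι) {F : ι → T ≃g T} {v y : V} (h : ∀ᶠ i in U, F i v = y) (z : V) :
    ∃ w, ∀ᶠ i in U, F i z = w := by
  refine mem_of_forall_adj (C := {z | ∃ w, ∀ᶠ i in U, F i z = w}) hT.connected ⟨y, h⟩ ?_ z
  rintro a b hab ⟨w, hw⟩
  have : ∀ᶠ i in U, ∃ c ∈ T.neighborSet w, F i b = c := by
    filter_upwards [hw] with i hi
    exact ⟨_, hi ▸ (F i).map_adj_iff.2 hab, rfl⟩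
  obtain ⟨c, -, hc⟩ := (Ultrafilter.eventually_exists_mem_iff (toFinite _)).1 this
  exact ⟨c, hc⟩

/-- An ultrafilter of automorphisms that does not escape from the set of automorphisms sending `v`
to `y` converges pointwise: this set is compact because `T` is locally finite. -/
theorem exists_limit [T.LocallyFinite] (hT : T.IsTree) {ι : Type*} (U : Ultrafilter ι)
    {F : ι → T ≃g T} {v y : V} (h : ∀ᶠ i in U, F i v = y) :
    ∃ g : T ≃g T, ∀ z, ∀ᶠ i in U, F i z = g z := by
  have h' : ∀ᶠ i in U, (F i)⁻¹ y = v := by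
    filter_upwards [h] with i hi
    rw [← hi, RelIso.inv_apply_self]
  choose a ha using exists_eventually_apply_eq hT U h
  choose b hb using exists_eventually_apply_eq hT U (F := fun i => (F i)⁻¹) h'
  refine ⟨⟨⟨a, b, fun z => ?_, fun z => ?_⟩, fun {z w} => ?_⟩, ha⟩
  · obtain ⟨i, h1, h2⟩ := ((ha z).and (hb (a z))).exists
    rw [← h2, ← h1, RelIso.inv_apply_self]
  · obtain ⟨i, h1, h2⟩ := ((hb z).and (ha (b z))).exists
    rw [← h2, ← h1, RelIso.apply_inv_self]
  · obtain ⟨i, h1, h2⟩ := ((ha z).and (ha w)).exists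
    change T.Adj (a z) (a w) ↔ T.Adj z w
    rw [← h1, ← h2, (F i).map_adj_iff]

theorem exists_le_nhds_plus_kClosure [T.LocallyFinite] (hT : T.IsTree) {G : Subgroup (T ≃g T)}
    {k : ℕ} (U : Ultrafilter (plus (kClosure G k) k)) {v y w : V} (hvw : T.Adj v w)
    (h : ∀ᶠ p : plus (kClosure G k) k in U, p.1 v = y) :
    ∃ g, (U : Filter (plus (kClosure G k) k)) ≤ 𝓝 g := by
  obtain ⟨g, hg⟩ := exists_limit hT U (F := fun p => p.1) h
  have hfin : ∀ S : Set V, S.Finite → ∃ p ∈ plus (kClosure G k) k, ∀ z ∈ S, p z = g z := by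
    intro S hS
    obtain ⟨p, hp⟩ := ((eventually_all_finite hS).2 fun z _ => hg z).exists
    exact ⟨p, p.2, hp⟩
  have hgk : g ∈ kClosure G k := by
    intro x
    obtain ⟨p, hp, hpg⟩ := hfin _ (ball_finite hT x k)
    obtain ⟨g₀, hg₀, hpg₀⟩ := plus_le _ _ hp x
    exact ⟨g₀, hg₀, fun z hz => by rw [← hpg z hz, hpg₀ z hz]⟩
  have hgP : g ∈ plus (kClosure G k) k := by
    obtain ⟨p, hp, hpg⟩ := hfin _ ((ball_finite hT v k).inter_of_left (ball T w k))
    have : p⁻¹ * g ∈ plus (kClosure G k) k := by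
      refine mem_plus_of_fix hvw
        ((kClosure G k).mul_mem ((kClosure G k).inv_mem (plus_le _ _ hp)) hgk) fun z hz => ?_
      rw [RelIso.mul_apply, ← hpg z hz, RelIso.inv_apply_self]
    simpa using (plus (kClosure G k) k).mul_mem hp this
  refine ⟨⟨g, hgP⟩, ?_⟩
  rw [← tendsto_id', tendsto_subtype_rng]
  exact tendsto_aut hg

/-- If an ultrafilter of automorphisms escapes to infinity, then the preimages of the vertices
converge to an end of the tree. -/
theorem exists_isEndMap [T.LocallyFinite] (hT : T.IsTree) {ι : Type*} (U : Ultrafilter ι)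
    {F : ι → T ≃g T} (h : ∀ v y, ∀ᶠ i in U, F i v ≠ y) :
    ∃ f, IsEndMap T f ∧ ∀ v x, ∀ᶠ i in U, (F i)⁻¹ x ∈ halfTree T v (f v) := by
  obtain ⟨x₀⟩ := hT.connected.nonempty
  have hne : ∀ x v, ∀ᶠ i in U, (F i)⁻¹ x ≠ v := by
    intro x v
    filter_upwards [h v x] with i hi hx
    exact hi (by rw [← hx, RelIso.apply_inv_self])
  have hdir : ∀ v, ∃ w ∈ T.neighborSet v, ∀ᶠ i in U, (F i)⁻¹ x₀ ∈ halfTree T v w := by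
    intro v
    rw [← Ultrafilter.eventually_exists_mem_iff (toFinite _)]
    filter_upwards [hne x₀ v] with i hi
    exact exists_mem_halfTree hT hi
  choose f hf hfU using hdir
  refine ⟨f, ⟨hf, fun x hx => ?_, fun x y hxy => ?_⟩, fun v x => ?_⟩
  · obtain ⟨i, h1, h2⟩ := ((hfU x).and (hfU (f x))).exists
    rw [hx] at h2
    exact (mem_halfTree_swap hT (hf x)).1 h2 h1
  · obtain ⟨i, h1, h2⟩ := ((hfU x).and (hfU y)).exists
    by_cases hi : (F i)⁻¹ x₀ ∈ halfTree T x y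
    · exact Or.inl (halfTree_unique hT (hf x) hxy h1 hi)
    · exact Or.inr (halfTree_unique hT (hf y) hxy.symm h2 ((mem_halfTree_swap hT hxy).2 hi))
  · refine mem_of_forall_adj (C := {x | ∀ᶠ i in U, (F i)⁻¹ x ∈ halfTree T v (f v)}) hT.connected
      (hfU v) (fun a b hab ha => ?_) x
    filter_upwards [ha, hne b v] with i hi hb
    by_contra hib
    exact hb (eq_of_adj_of_mem_of_notMem hT (hf v) ((F i)⁻¹.map_adj_iff.2 hab) hi hib).2

/-! ### The closed range property -/

/-- If `φ p` converges while `p` escapes to infinity so that the vertices `p⁻¹ x` converge to the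
end encoded by `f`, then `φ` kills every `u` fixing a half-tree that contains this end: `p u p⁻¹`
converges to the identity, whereas `φ (p u p⁻¹)` converges to a conjugate of `φ u`. -/
theorem map_eq_one_of_contracted {P : Subgroup (T ≃g T)} {H : Type v} [Group H]
    [TopologicalSpace H] [IsTopologicalGroup H] [T2Space H] {φ : P →* H} (hφ : Continuous φ)
    {l : Filter P} [l.NeBot] {h : H} (hl : Tendsto φ l (𝓝 h)) {f : V → V} {a : V}
    (hf : ∀ x, ∀ᶠ p : P in l, p.1⁻¹ x ∈ halfTree T a (f a)) {u : P}
    (hu : ∀ z ∈ halfTree T a (f a), (u : T ≃g T) z = z) : φ u = 1 := by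
  have h1 : Tendsto (fun p => p * u * p⁻¹) l (𝓝 1) := by
    rw [tendsto_subtype_rng]
    refine tendsto_aut fun z => ?_
    filter_upwards [hf z] with p hp
    change (p : T ≃g T) ((u : T ≃g T) ((p : T ≃g T)⁻¹ z)) = z
    rw [hu _ hp, RelIso.apply_inv_self]
  have h2 : Tendsto (fun p => φ (p * u * p⁻¹)) l (𝓝 (φ 1)) := (hφ.tendsto 1).comp h1
  have h3 : Tendsto (fun p => φ (p * u * p⁻¹)) l (𝓝 (h * φ u * h⁻¹)) := by
    simp only [map_mul, map_inv]
    exact (hl.mul_const _).mul hl.inv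
  rw [map_one] at h2
  simpa [mul_inv_eq_one] using tendsto_nhds_unique h3 h2

theorem closedRangeProperty_plus_kClosure [T.LocallyFinite] [Nontrivial V] (hT : T.IsTree)
    {G : Subgroup (T ≃g T)} (hG : GeomDense G) {k : ℕ} (hk : 1 ≤ k) :
    ClosedRangeProperty.{u, v} (plus (kClosure G k) k) := by
  set P := plus (kClosure G k) k
  intro H _ _ _ _ φ hφ
  have hle : ∀ N : Subgroup (T ≃g T), (∀ x y, T.Adj x y → ∀ u ∈ P,
      (∀ z ∈ halfTree T x y, u z = z) → u ∈ N) → P ≤ N := fun N hN => plus_kClosure_le hT hk hN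
  refine isClosed_of_closure_subset fun h hh => ?_
  have : (comap φ (𝓝 h)).NeBot := comap_neBot_iff_frequently.2 (mem_closure_iff_frequently.1 hh)
  set U := Ultrafilter.of (comap φ (𝓝 h))
  have hU : Tendsto φ U (𝓝 h) := tendsto_comap.mono_left (Ultrafilter.of_le _)
  by_cases hbdd : ∃ v y, ∀ᶠ p : P in U, p.1 v = y
  · obtain ⟨v, y, hvy⟩ := hbdd
    obtain ⟨x, hx⟩ := exists_ne v
    obtain ⟨w, hw, -⟩ := exists_mem_halfTree hT hx
    obtain ⟨g, hg⟩ := exists_le_nhds_plus_kClosure hT U hw hvy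
    exact ⟨g, tendsto_nhds_unique ((hφ.tendsto g).mono_left hg) hU⟩
  · have hesc : ∀ v y, ∀ᶠ p : P in U, p.1 v ≠ y := fun v y =>
      Ultrafilter.eventually_not.2 fun hvy => hbdd ⟨v, y, hvy⟩
    obtain ⟨f, hf, hfU⟩ := exists_isEndMap hT U (F := fun p : P => (p : T ≃g T)) hesc
    have hone : P ≤ φ.ker.map P.subtype := by
      refine hle _ fun a b hab u hu hfix => ?_
      refine ⟨⟨u, hu⟩, MonoidHom.mem_ker.2 ?_, rfl⟩
      rcases eq_or_ne u 1 with rfl | hu1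
      · exact map_one φ
      have hdense : GeomDense P := hG.of_normalised hT
        (fun g hg p hp => conj_mem_plus _ k g (le_kClosure G k hg) p hp) hu hu1
        (hfix b (mem_halfTree_self a b))
      obtain ⟨p, hp, hpab⟩ := hdense.exists_apply_eq hT hf hab
      have := map_eq_one_of_contracted hφ hU (hfU (p a)) (u := ⟨p, hp⟩ * ⟨u, hu⟩ * ⟨p, hp⟩⁻¹)
        fun z hz => by
          rw [hpab, ← RelIso.apply_inv_self p z, map_mem_halfTree hT p hab] at hz
          change p (u (p⁻¹ z)) = z
          rw [hfix _ hz, RelIso.apply_inv_self]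
      rwa [map_mul, map_mul, map_inv, mul_inv_eq_one, mul_eq_left] at this
    have hφ1 : ∀ p, φ p = 1 := by
      intro p
      obtain ⟨q, hq, hqp⟩ := hone p.2
      rw [← Subtype.ext hqp]
      exact hq
    refine ⟨1, tendsto_nhds_unique (f := φ) (l := U) ?_ hU⟩
    simp only [hφ1]
    exact tendsto_const_nhds.congr fun p => (hφ1 p).symm

end TreeAut

theorem mainTheorem7 {V : Type u} [Infinite V] (T : SimpleGraph V) [T.LocallyFinite]
    (hT : T.IsTree) (hleaf : ∀ x : V, T.degree x ≠ 1)
    (G : Subgroup (T ≃g T))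
    (hsub : ¬ ∃ S : T.Subgraph, S.coe.IsTree ∧ S ≠ ⊤ ∧ TreeAut.Stabilises G S)
    (hend : ¬ ∃ ε : TreeAut.Boundary T, TreeAut.FixesEnd G ε)
    (k : ℕ) (hk : 1 ≤ k) :
    TreeAut.ClosedRangeProperty.{u, v} ↥(TreeAut.plus (TreeAut.kClosure G k) k) :=
  TreeAut.closedRangeProperty_plus_kClosure hT (TreeAut.GeomDense.of_not_exists hT hsub hend) hk
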